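/- Let $p\ge 1$ and $N\ge 2$ be integers, let $s_n>0$ ($n\ge 1$) satisfy $\sum_n s_n<\infty$, and for each $n\ge 1$ let $\mathcal D^n=\{0=d^n_1,d^n_2,\dots,d^n_N\}\subset\mathbb R^p$ be a set of $N$ digits. Put $$C_{s,\mathcal D}=\Big\{\sum_{i=1}^\infty s_i b_i : b_i\in\mathcal D^i\Big\},\qquad R_n=\sum_{i>n}s_i\quad(n\ge 0),$$ $$\kappa=\sup_n\max_{i\ne j}\|d^n_i-d^n_j\|,\qquad \tau=\inf_n\min_{i\ne j}\|d^n_i-d^n_j\|,$$ where $\|\cdot\|$ is the Euclidean norm, and assume that $\kappa<\infty$, $\tau>0$ and $$\sup_{n\ge 1}\frac{\kappa R_n}{\tau s_n}=M<1 .$$ A dimension function is a continuous non-decreasing function $h:[0,\infty)\to[0,\infty)$ with $h(0)=0$; it is doubling if for some $c>0$ one has $h(2x)\le c\,h(x)$ for all $x>0$. Write $|B|$ for the diameter of $B$. The Hausdorff $h$-measure is $\mathcal H^h(E)=\lim_{\delta\to0}\inf\sum_i h(|B_i|)$, the infimum being over all countable covers of $E$ by sets $B_i$ with $|B_i|\le\delta$.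 The $h$-packing pre-measure is $\mathcal P^h_0(E)=\lim_{\delta\to0}\sup\sum_i h(|B_i|)$, the supremum being over all families of pairwise disjoint open balls $B_i$ with centres in $E$ and radii in $(0,\delta]$, and the $h$-packing measure is $\mathcal P^h(E)=\inf\{\sum_i\mathcal P^h_0(E_i):E\subseteq\bigcup_i E_i\}$, the infimum being over all countable covers of $E$. Then there is a doubling dimension function $h$ such that $$0<\mathcal H^h(C_{s,\mathcal D})<\infty\qquad\text{and}\qquad 0<\mathcal P^h(C_{s,\mathcal D})<\infty .$$ Moreover $h$ can be chosen so that $h(f(t))=1/t$ for all $t\ge 1$, where $f$ is the piecewise linear function on $[1,\infty)$ given by $$f(t)=\kappa R_n+\frac{\kappa R_{n+1}-\kappa R_n}{N^{n+1}-N^n}\,(t-N^n),\qquad t\in[N^n,N^{n+1}),\ n\ge 0 ;$$ in particular $N^n h(\kappa R_n)=1$ for every $n\ge 0$. -/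

import Mathlib

open MeasureTheory
open scoped ENNReal

noncomputable section

namespace SumSet

/-- A dimension function: continuous and non-decreasing on `[0, ∞)` with `h 0 = 0`
(hence non-negative there). The values of `h` at negative numbers play no role. -/
structure IsDimensionFunction (h : ℝ → ℝ) : Prop where
  continuousOn : ContinuousOn h (Set.Ici 0)
  monotoneOn : MonotoneOn h (Set.Ici 0)
  map_zero : h 0 = 0

/-- `h (2 x) ≤ c h(x)` for all `x > 0`, for some constant `c > 0`. -/
def IsDoubling (h : ℝ → ℝ) : Prop :=
  ∃ c : ℝ, 0 < c ∧ ∀ x : ℝ, 0 < x → h (2 * x) ≤ c * h x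

section Measures

variable {X : Type*}

/-- The Hausdorff `h`-measure. -/
def hausdorffMeasure [MetricSpace X] [MeasurableSpace X] [BorelSpace X]
    (h : ℝ → ℝ) : Measure X :=
  Measure.mkMetric fun r : ℝ≥0∞ => ENNReal.ofReal (h r.toReal)

/-- A `δ`-packing of `E`: a family of pairwise disjoint open balls `B(x, r)` with `x ∈ E` and
`0 < r ≤ δ`. It is given by the set of the pairs `(x, r)` of centres and radii. -/
def IsPacking [PseudoMetricSpace X] (δ : ℝ) (E : Set X) (B : Set (X × ℝ)) : Prop :=
  (∀ b ∈ B, b.1 ∈ E ∧ 0 < b.2 ∧ b.2 ≤ δ) ∧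
    B.PairwiseDisjoint fun b => Metric.ball b.1 b.2

/-- The supremum of `∑ h(|B_i|)` over all `δ`-packings of `E`, where `|·|` is the diameter. -/
def packingDelta [PseudoMetricSpace X] (h : ℝ → ℝ) (δ : ℝ) (E : Set X) : ℝ≥0∞ :=
  ⨆ (B : Set (X × ℝ)) (_ : IsPacking δ E B),
    ∑' b : B, ENNReal.ofReal (h (Metric.diam (Metric.ball b.1.1 b.1.2)))

/-- The `h`-packing pre-measure: the limit of `packingDelta h δ E` as `δ` decreases to `0`, which
is the infimum over `δ > 0` because `packingDelta h δ E` is non-decreasing in `δ`. -/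
def packingPremeasure [PseudoMetricSpace X] (h : ℝ → ℝ) (E : Set X) : ℝ≥0∞ :=
  ⨅ (δ : ℝ) (_ : 0 < δ), packingDelta h δ E

/-- The `h`-packing measure. -/
def packingMeasure [PseudoMetricSpace X] (h : ℝ → ℝ) (E : Set X) : ℝ≥0∞ :=
  ⨅ (F : ℕ → Set X) (_ : E ⊆ ⋃ i, F i), ∑' i, packingPremeasure h (F i)

/-- `E` is an `h`-Hausdorff set: its Hausdorff `h`-measure is positive and finite. -/
def IsHausdorffSet [MetricSpace X] [MeasurableSpace X] [BorelSpace X]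
    (h : ℝ → ℝ) (E : Set X) : Prop :=
  0 < hausdorffMeasure h E ∧ hausdorffMeasure h E < ∞

/-- `E` is an `h`-packing set: its `h`-packing measure is positive and finite. -/
def IsPackingSet [PseudoMetricSpace X] (h : ℝ → ℝ) (E : Set X) : Prop :=
  0 < packingMeasure h E ∧ packingMeasure h E < ∞

end Measures

/-! Sequences indexed by `1, 2, 3, …` in the mathematics are indexed from `0` here: `s n` and
`d n` stand for `s_{n+1}` and the digits of `D^{n+1}`. -/

/-- The tail `R_n = ∑_{i > n} s_i = s_{n+1} + s_{n+2} + ⋯`; since `s_{n+1}` is `s n`, this is the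
sum of `s n, s (n + 1), …`. In particular `tail s 0` is the full sum. -/
def tail (s : ℕ → ℝ) (n : ℕ) : ℝ := ∑' i, s (n + i)

section Digits

variable {p N : ℕ}

/-- The largest distance between digits with different indices in the `n`th digit set. -/
def kappaAt (d : ℕ → Fin N → EuclideanSpace ℝ (Fin p)) (n : ℕ) : ℝ :=
  ⨆ q : {q : Fin N × Fin N // q.1 ≠ q.2}, ‖d n q.1.1 - d n q.1.2‖

/-- The smallest distance between digits with different indices in the `n`th digit set. -/
def tauAt (d : ℕ → Fin N → EuclideanSpace ℝ (Fin p)) (n : ℕ) : ℝ :=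
  ⨅ q : {q : Fin N × Fin N // q.1 ≠ q.2}, ‖d n q.1.1 - d n q.1.2‖

def kappa (d : ℕ → Fin N → EuclideanSpace ℝ (Fin p)) : ℝ := ⨆ n, kappaAt d n

def tau (d : ℕ → Fin N → EuclideanSpace ℝ (Fin p)) : ℝ := ⨅ n, tauAt d n

/-- The sum set: all sums `∑ s_i b_i` with every `b_i` taken from the `i`th digit set. -/
def sumSet (s : ℕ → ℝ) (d : ℕ → Fin N → EuclideanSpace ℝ (Fin p)) :
    Set (EuclideanSpace ℝ (Fin p)) :=
  {x | ∃ b : ℕ → EuclideanSpace ℝ (Fin p),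
    (∀ i, b i ∈ Set.range (d i)) ∧ HasSum (fun i => s i • b i) x}

/-- The affine function that maps `N ^ n` to `κ R_n` and `N ^ (n + 1)` to `κ R_{n+1}`. -/
def interp (s : ℕ → ℝ) (d : ℕ → Fin N → EuclideanSpace ℝ (Fin p)) (n : ℕ) (t : ℝ) : ℝ :=
  kappa d * tail s n +
    (kappa d * tail s (n + 1) - kappa d * tail s n) / ((N : ℝ) ^ (n + 1) - (N : ℝ) ^ n) *
      (t - (N : ℝ) ^ n)

end Digits

end SumSet

end

/-! Code points of the sum set by digit sequences `w` and give code space the uniform Bernoulli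
measure. Write `a n = κ R_n` and, with the 0-based `s`, `ρ n = (1 - M) τ s n`. Codes agreeing below
`n` have images within `a n` (`dist_codedSum_le`). If they first differ at `n`, the term `n`
dominates the tail: their distance is at least `τ s n - κ R_{n+1} ≥ ρ n` (`le_dist_codedSum`); this
is where `M < 1` enters. The hypothesis also gives `R_{n+1} ≤ s n`, so `a (n + 1) ≤ a n / 2` and `ρ
n` is at least a fixed multiple of `a n`. The first makes the gauge with `h (a n) = N⁻ⁿ` doubling;
with the second, `h (ρ n) ≥ c N⁻ⁿ`. Thus `h` at scale `a n` or `ρ n` is comparable to the mass of a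
cylinder of length `n`. The four bounds compare masses: cylinders cover the set; a set of small
diameter has small mass; points in distinct cylinders carry disjoint balls; disjoint balls contain
disjoint cylinders. -/

open Filter Topology

namespace SumSet

/-! ### The gauge function -/

/-- The inverse, on `[a m, ∞)`, of the piecewise linear function that maps `N ^ n` to `a n`;
it is constant equal to `N ^ m` on `(-∞, a m]` and equal to `1` on `[a 0, ∞)`. -/
noncomputable def truncatedInverse (N : ℕ) (a : ℕ → ℝ) (m : ℕ) (x : ℝ) : ℝ :=
  1 + ∑ n ∈ Finset.range m, ((N : ℝ) ^ (n + 1) - (N : ℝ) ^ n) *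
    max 0 (min 1 ((a n - x) / (a n - a (n + 1))))

/-- The function `h` with `h (f t) = 1 / t`, where `f` is the piecewise linear function that maps
`N ^ n` to `a n`. -/
noncomputable def gauge (N : ℕ) (a : ℕ → ℝ) (x : ℝ) : ℝ :=
  ⨅ m, (truncatedInverse N a m x)⁻¹

section Gauge

variable {N : ℕ} {a : ℕ → ℝ}

lemma pow_succ_sub_pow_pos (hN : 2 ≤ N) (n : ℕ) : 0 < (N : ℝ) ^ (n + 1) - (N : ℝ) ^ n := by
  have : (1 : ℝ) < N := by exact_mod_cast hN
  exact sub_pos.2 (pow_lt_pow_right₀ this n.lt_succ_self)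

lemma truncatedInverse_succ (m : ℕ) (x : ℝ) :
    truncatedInverse N a (m + 1) x = truncatedInverse N a m x +
      ((N : ℝ) ^ (m + 1) - (N : ℝ) ^ m) * max 0 (min 1 ((a m - x) / (a m - a (m + 1)))) := by
  simp only [truncatedInverse, Finset.sum_range_succ, add_assoc]

lemma monotone_truncatedInverse (hN : 2 ≤ N) (x : ℝ) :
    Monotone fun m => truncatedInverse N a m x := by
  refine monotone_nat_of_le_succ fun m => ?_
  rw [truncatedInverse_succ]
  have := pow_succ_sub_pow_pos hN m
  exact le_add_of_nonneg_right (by positivity)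

lemma one_le_truncatedInverse (hN : 2 ≤ N) (m : ℕ) (x : ℝ) :
    1 ≤ truncatedInverse N a m x := by
  have := monotone_truncatedInverse (a := a) hN x (Nat.zero_le m)
  simpa [truncatedInverse] using this

lemma antitone_truncatedInverse (hN : 2 ≤ N) (ha : StrictAnti a) (m : ℕ) :
    Antitone (truncatedInverse N a m) := by
  intro x y hxy
  unfold truncatedInverse
  gcongr with n _
  · exact (pow_succ_sub_pow_pos hN n).le
  · exact (sub_pos.2 (ha n.lt_succ_self)).le

lemma continuous_truncatedInverse (m : ℕ) : Continuous (truncatedInverse N a m) := by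
  unfold truncatedInverse
  fun_prop

lemma truncatedInverse_eq_pow (ha : StrictAnti a) {m : ℕ} {x : ℝ} (hx : x ≤ a m) :
    truncatedInverse N a m x = (N : ℝ) ^ m := by
  have : ∀ n ∈ Finset.range m, ((N : ℝ) ^ (n + 1) - (N : ℝ) ^ n) *
      max 0 (min 1 ((a n - x) / (a n - a (n + 1)))) = (N : ℝ) ^ (n + 1) - (N : ℝ) ^ n := by
    intro n hn
    have h1 : a m ≤ a (n + 1) := ha.antitone (Finset.mem_range.1 hn)
    have h2 : 1 ≤ (a n - x) / (a n - a (n + 1)) := by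
      rw [one_le_div (sub_pos.2 (ha n.lt_succ_self))]
      linarith
    simp [min_eq_left h2]
  rw [truncatedInverse, Finset.sum_congr rfl this, Finset.sum_range_sub (fun n => (N : ℝ) ^ n)]
  simp

/-- The summands with index at least `k` vanish to the right of `a k`, so there the infimum defining
`gauge` stabilises at `k`. -/
lemma truncatedInverse_eq_of_le (ha : StrictAnti a) {k m : ℕ} (hkm : k ≤ m) {x : ℝ}
    (hx : a k ≤ x) : truncatedInverse N a m x = truncatedInverse N a k x := by
  induction m, hkm using Nat.le_induction with
  | base => rfl
  | succ m hkm ih =>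
    have h1 : (a m - x) / (a m - a (m + 1)) ≤ 0 :=
      div_nonpos_of_nonpos_of_nonneg (by linarith [ha.antitone hkm])
        (sub_pos.2 (ha m.lt_succ_self)).le
    rw [truncatedInverse_succ, ih, max_eq_left ((min_le_right _ _).trans h1), mul_zero, add_zero]

lemma bddBelow_range_inv_truncatedInverse (hN : 2 ≤ N) (x : ℝ) :
    BddBelow (Set.range fun m => (truncatedInverse N a m x)⁻¹) := by
  refine ⟨0, ?_⟩
  rintro _ ⟨m, rfl⟩
  exact inv_nonneg.2 (zero_le_one.trans (one_le_truncatedInverse hN m x))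

lemma gauge_nonneg (hN : 2 ≤ N) (x : ℝ) : 0 ≤ gauge N a x :=
  le_ciInf fun m => inv_nonneg.2 (zero_le_one.trans (one_le_truncatedInverse hN m x))

lemma gauge_le (hN : 2 ≤ N) (m : ℕ) (x : ℝ) : gauge N a x ≤ (truncatedInverse N a m x)⁻¹ :=
  ciInf_le (bddBelow_range_inv_truncatedInverse hN x) m

lemma gauge_le_one (hN : 2 ≤ N) (x : ℝ) : gauge N a x ≤ 1 := by
  simpa [truncatedInverse] using gauge_le (a := a) hN 0 x

lemma gauge_eq_of_le (hN : 2 ≤ N) (ha : StrictAnti a) {k : ℕ} {x : ℝ} (hx : a k ≤ x) :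
    gauge N a x = (truncatedInverse N a k x)⁻¹ := by
  refine le_antisymm (gauge_le hN k x) (le_ciInf fun m => ?_)
  refine inv_anti₀ (zero_lt_one.trans_le (one_le_truncatedInverse hN m x)) ?_
  rcases le_total k m with h | h
  · exact (truncatedInverse_eq_of_le ha h hx).le
  · exact monotone_truncatedInverse hN x h

lemma monotone_gauge (hN : 2 ≤ N) (ha : StrictAnti a) : Monotone (gauge N a) := by
  intro x y hxy
  refine ciInf_mono (bddBelow_range_inv_truncatedInverse hN x) fun m => ?_
  exact inv_anti₀ (zero_lt_one.trans_le (one_le_truncatedInverse hN m y))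
    (antitone_truncatedInverse hN ha m hxy)

lemma gauge_apply (hN : 2 ≤ N) (ha : StrictAnti a) (n : ℕ) :
    gauge N a (a n) = ((N : ℝ) ^ n)⁻¹ := by
  rw [gauge_eq_of_le hN ha le_rfl, truncatedInverse_eq_pow ha le_rfl]

lemma tendsto_inv_pow_zero (hN : 2 ≤ N) : Tendsto (fun n => ((N : ℝ) ^ n)⁻¹) atTop (𝓝 0) :=
  (tendsto_pow_atTop_atTop_of_one_lt (by exact_mod_cast hN)).inv_tendsto_atTop

lemma gauge_zero (hN : 2 ≤ N) (ha : StrictAnti a) (ha0 : ∀ n, 0 < a n) : gauge N a 0 = 0 := by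
  refine le_antisymm ?_ (gauge_nonneg hN 0)
  refine ge_of_tendsto' (tendsto_inv_pow_zero hN) fun n => ?_
  rw [← gauge_apply hN ha]
  exact monotone_gauge hN ha (ha0 n).le

/-- The convergence of the truncations is uniform: the `m`th one is exact on `[a m, ∞)`, and to the
left of `a m` both functions lie in `[0, N⁻ᵐ]`. -/
lemma continuous_gauge (hN : 2 ≤ N) (ha : StrictAnti a) : Continuous (gauge N a) := by
  have hlim : TendstoUniformly (fun m x => (truncatedInverse N a m x)⁻¹) (gauge N a) atTop := by
    rw [Metric.tendstoUniformly_iff]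
    intro ε hε
    filter_upwards [(tendsto_inv_pow_zero hN).eventually (gt_mem_nhds hε)] with m hm x
    rcases le_total (a m) x with h | h
    · rwa [gauge_eq_of_le hN ha h, dist_self]
    · have h1 := gauge_le (a := a) hN m x
      rw [dist_comm, Real.dist_eq, abs_of_nonneg (sub_nonneg.2 h1)]
      rw [truncatedInverse_eq_pow ha h]
      linarith [gauge_nonneg (a := a) hN x]
  refine hlim.continuous (Frequently.of_forall fun m => ?_)
  exact (continuous_truncatedInverse m).inv₀ fun x =>
    (zero_lt_one.trans_le (one_le_truncatedInverse hN m x)).ne'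

lemma gauge_interpolation (hN : 2 ≤ N) (ha : StrictAnti a) {n : ℕ} {t : ℝ}
    (ht : t ∈ Set.Ico ((N : ℝ) ^ n) ((N : ℝ) ^ (n + 1))) :
    gauge N a (a n + (a (n + 1) - a n) / ((N : ℝ) ^ (n + 1) - (N : ℝ) ^ n) * (t - (N : ℝ) ^ n)) =
      1 / t := by
  have hD := pow_succ_sub_pow_pos hN n
  have hA : 0 < a n - a (n + 1) := sub_pos.2 (ha n.lt_succ_self)
  set u := (t - (N : ℝ) ^ n) / ((N : ℝ) ^ (n + 1) - (N : ℝ) ^ n) with hu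
  have hu0 : 0 ≤ u := div_nonneg (by linarith [ht.1]) hD.le
  have hu1 : u ≤ 1 := by rw [hu, div_le_one hD]; linarith [ht.2]
  have hx : a n + (a (n + 1) - a n) / ((N : ℝ) ^ (n + 1) - (N : ℝ) ^ n) * (t - (N : ℝ) ^ n) =
      a n - (a n - a (n + 1)) * u := by rw [hu]; ring
  have hr : (a n - (a n - (a n - a (n + 1)) * u)) / (a n - a (n + 1)) = u := by
    field_simp
    ring
  have hDu : ((N : ℝ) ^ (n + 1) - (N : ℝ) ^ n) * u = t - (N : ℝ) ^ n := by
    rw [hu]; exact mul_div_cancel₀ _ hD.ne'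
  rw [hx, gauge_eq_of_le hN ha (k := n + 1) (by nlinarith), truncatedInverse_succ,
    truncatedInverse_eq_pow ha (by nlinarith), hr, min_eq_right hu1, max_eq_right hu0, hDu]
  simp

lemma exists_apply_lt (ha_lim : Tendsto a atTop (𝓝 0)) {x : ℝ} (hx : 0 < x) : ∃ n, a n < x :=
  (ha_lim.eventually (gt_mem_nhds hx)).exists

/-- Since `a` at least halves at each step, doubling `x` costs at most two levels counted from the
first `n` with `a n < x`, hence the factor `N ^ 2`. For `n ≤ 1` the bound `gauge ≤ 1` suffices. -/
lemma gauge_two_mul_le (hN : 2 ≤ N) (ha : StrictAnti a) (ha_lim : Tendsto a atTop (𝓝 0))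
    (ha_two : ∀ n, 2 * a (n + 1) ≤ a n) {x : ℝ} (hx : 0 < x) :
    gauge N a (2 * x) ≤ (N : ℝ) ^ 2 * gauge N a x := by
  classical
  have hex := exists_apply_lt ha_lim hx
  have hlt : a (Nat.find hex) < x := Nat.find_spec hex
  have hmin : ∀ m < Nat.find hex, x ≤ a m := fun m hm => not_lt.1 (Nat.find_min hex hm)
  have hN0 : (0 : ℝ) < N := by exact_mod_cast (by omega : 0 < N)
  have hN1 : (1 : ℝ) ≤ N := by exact_mod_cast (by omega : 1 ≤ N)
  have hlow : ((N : ℝ) ^ Nat.find hex)⁻¹ ≤ gauge N a x := by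
    rw [← gauge_apply hN ha]
    exact monotone_gauge hN ha hlt.le
  refine le_trans ?_ (mul_le_mul_of_nonneg_left hlow (by positivity))
  rcases hn : Nat.find hex with _ | _ | n
  · refine (gauge_le_one hN _).trans ?_
    simpa using (by omega : 1 ≤ N)
  · refine (gauge_le_one hN _).trans ?_
    have : (N : ℝ) ^ 2 * ((N : ℝ) ^ (0 + 1))⁻¹ = N := by field_simp; ring
    rwa [this]
  · have h1 : 2 * x ≤ a n := by linarith [hmin (n + 1) (by omega), ha_two n]
    refine (monotone_gauge hN ha h1).trans ?_
    rw [gauge_apply hN ha]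
    have : (N : ℝ) ^ 2 * ((N : ℝ) ^ (n + 1 + 1))⁻¹ = ((N : ℝ) ^ n)⁻¹ := by field_simp; ring
    rw [this]

end Gauge

/-- A doubling monotone function changes by a bounded factor under a scaling of its variable. -/
lemma exists_mul_le_of_doubling {h : ℝ → ℝ} {C : ℝ} (hC : 0 < C) (hmono : Monotone h)
    (hdoubling : ∀ x, 0 < x → h (2 * x) ≤ C * h x) {θ : ℝ} (hθ : 0 < θ) :
    ∃ c, 0 < c ∧ ∀ x, 0 < x → c * h x ≤ h (θ * x) := by
  obtain ⟨k, hk⟩ := pow_unbounded_of_one_lt θ⁻¹ (one_lt_two (α := ℝ))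
  have hiter : ∀ (k : ℕ) (x : ℝ), 0 < x → h (2 ^ k * x) ≤ C ^ k * h x := by
    intro k
    induction k with
    | zero => simp
    | succ k ih =>
      intro x hx
      calc h (2 ^ (k + 1) * x) = h (2 * (2 ^ k * x)) := by ring_nf
        _ ≤ C * h (2 ^ k * x) := hdoubling _ (by positivity)
        _ ≤ C * (C ^ k * h x) := by gcongr; exact ih x hx
        _ = C ^ (k + 1) * h x := by ring
  refine ⟨(C ^ k)⁻¹, by positivity, fun x hx => ?_⟩
  rw [inv_mul_le_iff₀ (by positivity)]
  refine le_trans (hmono ?_) (hiter k (θ * x) (by positivity))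
  have : 1 ≤ 2 ^ k * θ := by
    rw [← inv_mul_cancel₀ hθ.ne']
    gcongr
  nlinarith

/-! ### Code space and the uniform measure -/

/-- The set of the codes that begin with the word `v`. -/
def codeCylinder {N : ℕ} (n : ℕ) (v : Fin n → Fin N) : Set (ℕ → Fin N) :=
  {w | ∀ i : Fin n, w i = v i}

/-- The uniform Bernoulli measure on the space of codes. -/
noncomputable def codeMeasure (N : ℕ) [NeZero N] : Measure (ℕ → Fin N) :=
  Measure.infinitePi fun _ => ProbabilityTheory.uniformOn Set.univ

section Coding

variable {N : ℕ}

instance [NeZero N] : IsProbabilityMeasure (codeMeasure N) := by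
  unfold codeMeasure
  infer_instance

lemma codeCylinder_eq_pi (n : ℕ) (u : ℕ → Fin N) :
    codeCylinder n (fun i => u i) = Set.pi (Finset.range n) fun i => {u i} := by
  ext w
  simp only [codeCylinder, Set.mem_ofPred_eq, Set.mem_pi, Finset.coe_range, Set.mem_Iio,
    Set.mem_singleton_iff]
  exact ⟨fun h i hi => h ⟨i, hi⟩, fun h i => h i i.2⟩

lemma exists_code_extending [NeZero N] {n : ℕ} (v : Fin n → Fin N) :
    ∃ u : ℕ → Fin N, (fun i : Fin n => u i) = v :=
  ⟨fun i => if h : i < n then v ⟨i, h⟩ else 0, by ext i; simp⟩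

lemma measurableSet_codeCylinder [NeZero N] {n : ℕ} (v : Fin n → Fin N) :
    MeasurableSet (codeCylinder n v) := by
  obtain ⟨u, rfl⟩ := exists_code_extending v
  rw [codeCylinder_eq_pi]
  exact MeasurableSet.pi (Finset.countable_toSet _) fun i _ => measurableSet_singleton _

lemma codeMeasure_codeCylinder [NeZero N] {n : ℕ} (v : Fin n → Fin N) :
    codeMeasure N (codeCylinder n v) = ENNReal.ofReal ((N : ℝ) ^ n)⁻¹ := by
  obtain ⟨u, rfl⟩ := exists_code_extending v
  have hN : (0 : ℝ) < N := by exact_mod_cast Nat.pos_of_neZero N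
  rw [codeCylinder_eq_pi, codeMeasure,
    Measure.infinitePi_pi _ fun i _ => measurableSet_singleton _]
  simp only [ProbabilityTheory.uniformOn_univ, Measure.count_singleton, Fintype.card_fin,
    Finset.prod_const, Finset.card_range]
  rw [ENNReal.ofReal_inv_of_pos (by positivity), ENNReal.ofReal_pow hN.le, ENNReal.ofReal_natCast,
    one_div, ENNReal.inv_pow]

lemma sum_ofReal_inv_pow [NeZero N] (n : ℕ) :
    ∑ _v : Fin n → Fin N, ENNReal.ofReal ((N : ℝ) ^ n)⁻¹ = 1 := by
  have hN : (0 : ℝ) < N := by exact_mod_cast Nat.pos_of_neZero N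
  rw [Finset.sum_const, Finset.card_univ, Fintype.card_fun, Fintype.card_fin, Fintype.card_fin,
    nsmul_eq_mul, ← ENNReal.ofReal_natCast, ← ENNReal.ofReal_mul (by positivity)]
  push_cast
  rw [mul_inv_cancel₀ (by positivity), ENNReal.ofReal_one]

lemma codeMeasure_le_of_agree [NeZero N] {n : ℕ} {A : Set (ℕ → Fin N)}
    (hA : ∀ w ∈ A, ∀ w' ∈ A, ∀ i < n, w i = w' i) :
    codeMeasure N A ≤ ENNReal.ofReal ((N : ℝ) ^ n)⁻¹ := by
  rcases A.eq_empty_or_nonempty with rfl | ⟨u, hu⟩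
  · simp
  · rw [← codeMeasure_codeCylinder fun i : Fin n => u i]
    exact measure_mono fun w hw i => hA w hw u hu i i.2

/-! ### Hausdorff and packing bounds for a coded set -/

variable {X : Type*} [MetricSpace X] {φ : (ℕ → Fin N) → X} {a ρ : ℕ → ℝ} {h : ℝ → ℝ}

/-- The cover by the images of cylinders bounds the Hausdorff measure from above. -/
lemma hausdorffMeasure_range_le_one [MeasurableSpace X] [BorelSpace X] [NeZero N]
    (hφ : ∀ n w w', (∀ i < n, w i = w' i) → dist (φ w) (φ w') ≤ a n)
    (ha : ∀ n, 0 ≤ a n) (ha_lim : Tendsto a atTop (𝓝 0)) (hmono : Monotone h)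
    (hha : ∀ n, h (a n) = ((N : ℝ) ^ n)⁻¹) :
    hausdorffMeasure h (Set.range φ) ≤ 1 := by
  have hdiam : ∀ n (v : Fin n → Fin N),
      Metric.ediam (φ '' codeCylinder n v) ≤ ENNReal.ofReal (a n) := by
    intro n v
    refine Metric.ediam_le ?_
    rintro _ ⟨w, hw, rfl⟩ _ ⟨w', hw', rfl⟩
    rw [edist_dist]
    refine ENNReal.ofReal_le_ofReal (hφ n w w' fun i hi => ?_)
    exact (hw ⟨i, hi⟩).trans (hw' ⟨i, hi⟩).symm
  have hr : Tendsto (fun n => ENNReal.ofReal (a n)) atTop (𝓝 0) := by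
    simpa using ENNReal.tendsto_ofReal ha_lim
  refine (Measure.mkMetric_le_liminf_sum (Set.range φ) _ hr
    (fun n (v : Fin n → Fin N) => φ '' codeCylinder n v) (Eventually.of_forall hdiam)
    (Eventually.of_forall fun n => ?_) _).trans ?_
  · rintro _ ⟨w, rfl⟩
    exact Set.mem_iUnion.2 ⟨fun i => w i, w, fun _ => rfl, rfl⟩
  · refine liminf_le_of_le (by isBoundedDefault) fun b hb => ?_
    obtain ⟨n, hn⟩ := hb.exists
    refine hn.trans ((Finset.sum_le_sum fun v _ => ?_).trans_eq (sum_ofReal_inv_pow (N := N) n))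
    refine ENNReal.ofReal_le_ofReal ?_
    rw [← hha]
    exact hmono (ENNReal.toReal_le_of_le_ofReal (ha n) (hdiam n v))

/-- The mass of a set of small diameter is controlled by the gauge of its diameter. -/
lemma codeMeasure_preimage_le [NeZero N] (hN : 2 ≤ N)
    (hφ : ∀ n w w', dist (φ w) (φ w') < ρ n → ∀ i ≤ n, w i = w' i)
    (hρ : ∀ n, 0 < ρ n) (hρ_lim : Tendsto ρ atTop (𝓝 0)) (hmono : Monotone h) {c : ℝ} (hc : 0 < c)
    (hhρ : ∀ n, c * ((N : ℝ) ^ n)⁻¹ ≤ h (ρ n)) {U : Set X} (hU : Metric.ediam U ≠ ∞) :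
    ENNReal.ofReal c * codeMeasure N (φ ⁻¹' U) ≤ ENNReal.ofReal (h (Metric.ediam U).toReal) := by
  classical
  have hdist : ∀ w ∈ φ ⁻¹' U, ∀ w' ∈ φ ⁻¹' U, dist (φ w) (φ w') ≤ (Metric.ediam U).toReal :=
    fun w hw w' hw' => Metric.dist_le_diam_of_mem' hU hw hw'
  -- If the diameter is zero, all codes in the preimage agree to every order, so it is null.
  rcases (ENNReal.toReal_nonneg (a := Metric.ediam U)).eq_or_lt with h0 | h0
  · have hzero : codeMeasure N (φ ⁻¹' U) ≤ 0 := by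
      have hlim : Tendsto (fun n => ENNReal.ofReal ((N : ℝ) ^ n)⁻¹) atTop (𝓝 0) := by
        simpa using ENNReal.tendsto_ofReal (tendsto_inv_pow_zero hN)
      refine ge_of_tendsto' hlim fun n => codeMeasure_le_of_agree fun w hw w' hw' i hi => ?_
      refine hφ n w w' ((hdist w hw w' hw').trans_lt ?_) i hi.le
      rw [← h0]
      exact hρ n
    rw [le_zero_iff.1 hzero, mul_zero]
    exact zero_le
  · have hex : ∃ n, ρ n < (Metric.ediam U).toReal := exists_apply_lt hρ_lim h0
    -- At the least such `n` the diameter is below `ρ i` for each `i < n`, which forces agreement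
    -- below `n`.
    have hex' : ∃ n, ρ n ≤ (Metric.ediam U).toReal := hex.imp fun _ => le_of_lt
    have hspec := Nat.find_spec hex'
    have hmin : ∀ m < Nat.find hex', (Metric.ediam U).toReal < ρ m :=
      fun m hm => not_le.1 (Nat.find_min hex' hm)
    have hmeas : codeMeasure N (φ ⁻¹' U) ≤ ENNReal.ofReal ((N : ℝ) ^ Nat.find hex')⁻¹ := by
      refine codeMeasure_le_of_agree fun w hw w' hw' i hi => ?_
      exact hφ i w w' ((hdist w hw w' hw').trans_lt (hmin i hi)) i le_rfl
    calc ENNReal.ofReal c * codeMeasure N (φ ⁻¹' U)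
        ≤ ENNReal.ofReal c * ENNReal.ofReal ((N : ℝ) ^ Nat.find hex')⁻¹ := by gcongr
      _ = ENNReal.ofReal (c * ((N : ℝ) ^ Nat.find hex')⁻¹) := (ENNReal.ofReal_mul hc.le).symm
      _ ≤ _ := ENNReal.ofReal_le_ofReal ((hhρ _).trans (hmono hspec))

/-- Mass distribution principle: the preimages of a cover carry total mass at least 1. -/
lemma le_hausdorffMeasure_range [MeasurableSpace X] [BorelSpace X] [NeZero N] (hN : 2 ≤ N)
    (hφ : ∀ n w w', dist (φ w) (φ w') < ρ n → ∀ i ≤ n, w i = w' i)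
    (hρ : ∀ n, 0 < ρ n) (hρ_lim : Tendsto ρ atTop (𝓝 0)) (hmono : Monotone h) {c : ℝ} (hc : 0 < c)
    (hhρ : ∀ n, c * ((N : ℝ) ^ n)⁻¹ ≤ h (ρ n)) :
    ENNReal.ofReal c ≤ hausdorffMeasure h (Set.range φ) := by
  rw [hausdorffMeasure, Measure.mkMetric_apply]
  refine le_iSup₂_of_le 1 one_pos (le_iInf fun t => le_iInf fun ht => le_iInf fun htd => ?_)
  have hcover : (Set.univ : Set (ℕ → Fin N)) ⊆ ⋃ n, φ ⁻¹' t n := by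
    intro w _
    simpa using ht ⟨w, rfl⟩
  calc ENNReal.ofReal c = ENNReal.ofReal c * codeMeasure N Set.univ := by simp
    _ ≤ ENNReal.ofReal c * ∑' n, codeMeasure N (φ ⁻¹' t n) := by
      gcongr
      exact (measure_mono hcover).trans (measure_iUnion_le _)
    _ = ∑' n, ENNReal.ofReal c * codeMeasure N (φ ⁻¹' t n) := ENNReal.tsum_mul_left.symm
    _ ≤ _ := by
      refine ENNReal.tsum_le_tsum fun n => ?_
      rcases (t n).eq_empty_or_nonempty with he | hne
      · simp [he]
      · simp only [hne, iSup_pos]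
        exact codeMeasure_preimage_le hN hφ hρ hρ_lim hmono hc hhρ
          (ne_top_of_le_ne_top ENNReal.one_ne_top (htd n))

lemma packingPremeasure_empty : packingPremeasure h (∅ : Set X) = 0 := by
  refine le_zero_iff.1 (iInf₂_le_of_le 1 one_pos (iSup₂_le fun B hB => ?_))
  have : B = ∅ := Set.eq_empty_of_forall_notMem fun b hb => (hB.1 b hb).1
  subst this
  simp

lemma packingMeasure_le_packingPremeasure (E : Set X) :
    packingMeasure h E ≤ packingPremeasure h E := by
  refine iInf₂_le_of_le (fun n => if n = 0 then E else ∅) ?_ ?_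
  · exact fun x hx => Set.mem_iUnion.2 ⟨0, by simpa using hx⟩
  · rw [tsum_eq_single 0 fun n hn => by simp [hn, packingPremeasure_empty]]
    simp

/-- Disjoint balls contain disjoint cylinders of comparable gauge. -/
lemma packingPremeasure_range_le [NeZero N]
    (hφ : ∀ n w w', (∀ i < n, w i = w' i) → dist (φ w) (φ w') ≤ a n)
    (ha : ∀ n, 0 < a n) (ha_lim : Tendsto a atTop (𝓝 0)) (hmono : Monotone h)
    (hha : ∀ n, h (a n) = ((N : ℝ) ^ n)⁻¹) {C : ℝ} (hC : 0 < C)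
    (hdoubling : ∀ x, 0 < x → h (2 * x) ≤ C * h x) :
    packingPremeasure h (Set.range φ) ≤ ENNReal.ofReal (C * N) := by
  classical
  have hN : (0 : ℝ) < N := by exact_mod_cast Nat.pos_of_neZero N
  -- Radii at most `a 0` ensure that the first `n` with `a n < r` is positive.
  refine iInf₂_le_of_le (a 0) (ha 0) (iSup₂_le fun B hB => ?_)
  have hcyl : ∀ b : B, ∃ A : Set (ℕ → Fin N), MeasurableSet A ∧ A ⊆ φ ⁻¹' Metric.ball b.1.1 b.1.2 ∧
      ENNReal.ofReal (h (Metric.diam (Metric.ball b.1.1 b.1.2))) ≤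
        ENNReal.ofReal (C * N) * codeMeasure N A := by
    rintro ⟨⟨x, r⟩, hb⟩
    obtain ⟨⟨w, rfl⟩, hr0, hr⟩ := hB.1 _ hb
    dsimp only at hr0 hr ⊢
    have hex := exists_apply_lt ha_lim hr0
    obtain ⟨m, hm⟩ : ∃ m, Nat.find hex = m + 1 := by
      refine Nat.exists_eq_succ_of_ne_zero fun h0 => ?_
      have := Nat.find_spec hex
      rw [h0] at this
      exact absurd this (not_lt.2 hr)
    have hlt : a (m + 1) < r := hm ▸ Nat.find_spec hex
    have hle : r ≤ a m := not_lt.1 (Nat.find_min hex (by omega))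
    refine ⟨codeCylinder (m + 1) fun i => w i, measurableSet_codeCylinder _, fun w' hw' => ?_, ?_⟩
    · exact (hφ (m + 1) w' w fun i hi => hw' ⟨i, hi⟩).trans_lt hlt
    · rw [codeMeasure_codeCylinder, ← ENNReal.ofReal_mul (by positivity)]
      refine ENNReal.ofReal_le_ofReal ?_
      -- `C` pays for passing from radius to diameter, `N` for passing from level `m` to `m + 1`.
      calc h (Metric.diam (Metric.ball (φ w) r)) ≤ h (2 * r) := hmono (Metric.diam_ball hr0.le)
        _ ≤ C * h r := hdoubling r hr0
        _ ≤ C * h (a m) := by gcongr; exact hmono hle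
        _ = C * N * ((N : ℝ) ^ (m + 1))⁻¹ := by rw [hha, pow_succ]; field_simp
  choose A hA hAsub hAle using hcyl
  have hdisj : Pairwise (Function.onFun Disjoint A) := by
    intro b b' hbb'
    refine Disjoint.mono (hAsub b) (hAsub b') (Disjoint.preimage φ ?_)
    exact hB.2 b.2 b'.2 fun heq => hbb' (Subtype.ext heq)
  calc ∑' b : B, ENNReal.ofReal (h (Metric.diam (Metric.ball b.1.1 b.1.2)))
      ≤ ∑' b : B, ENNReal.ofReal (C * N) * codeMeasure N (A b) := ENNReal.tsum_le_tsum hAle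
    _ = ENNReal.ofReal (C * N) * ∑' b : B, codeMeasure N (A b) := ENNReal.tsum_mul_left
    _ ≤ ENNReal.ofReal (C * N) * 1 := by
      gcongr
      exact (tsum_meas_le_meas_iUnion_of_disjoint _ hA hdisj).trans prob_le_one
    _ = ENNReal.ofReal (C * N) := mul_one _

end Coding

section NormedCoding

variable {N : ℕ} {E : Type*} [NormedAddCommGroup E] [NormedSpace ℝ E] [Nontrivial E]
  {φ : (ℕ → Fin N) → E} {ρ : ℕ → ℝ} {h : ℝ → ℝ}

/-- Points of a set in different cylinders are centres of disjoint balls, so that the packing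
pre-measure dominates the mass. -/
lemma le_packingPremeasure [NeZero N]
    (hφ : ∀ n w w', dist (φ w) (φ w') < ρ n → ∀ i ≤ n, w i = w' i)
    (hρ : ∀ n, 0 < ρ n) (hρ_lim : Tendsto ρ atTop (𝓝 0)) {c : ℝ} (hc : 0 < c)
    (hhρ : ∀ n, c * ((N : ℝ) ^ n)⁻¹ ≤ h (ρ n)) (F : Set E) :
    ENNReal.ofReal c * codeMeasure N (φ ⁻¹' F) ≤ packingPremeasure h F := by
  have hN1 : (1 : ℝ) ≤ N := by exact_mod_cast Nat.pos_of_neZero N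
  refine le_iInf₂ fun δ hδ => ?_
  obtain ⟨n, hn⟩ := exists_apply_lt hρ_lim hδ
  -- The length is `n + 1` because distance below `ρ n` forces agreement up to and including `n`.
  let V := {v : Fin (n + 1) → Fin N // ∃ w ∈ codeCylinder (n + 1) v, φ w ∈ F}
  choose w hw hwF using fun v : V => v.2
  have hsep : ∀ v v' : V, v ≠ v' → ρ n ≤ dist (φ (w v)) (φ (w v')) := by
    intro v v' hvv'
    by_contra! hlt
    refine hvv' (Subtype.ext (funext fun i => ?_))
    rw [← hw v i, ← hw v' i]
    exact hφ n _ _ hlt i (Nat.lt_succ_iff.1 i.2)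
  let g : V → E × ℝ := fun v => (φ (w v), ρ n / 2)
  have hg : Function.Injective g := by
    intro v v' hvv'
    by_contra hne
    have := hsep v v' hne
    rw [show φ (w v) = φ (w v') from congrArg Prod.fst hvv', dist_self] at this
    exact absurd (hρ n) (not_lt.2 this)
  have hpack : IsPacking δ F (Set.range g) := by
    constructor
    · rintro _ ⟨v, rfl⟩
      have := hρ n
      exact ⟨hwF v, by simp only [g]; linarith, by simp only [g]; linarith⟩
    · rintro _ ⟨v, rfl⟩ _ ⟨v', rfl⟩ hne
      refine Metric.ball_disjoint_ball ?_
      simp only [g, add_halves]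
      exact hsep v v' fun heq => hne (congrArg g heq)
  refine le_trans ?_ (le_iSup₂_of_le (Set.range g) hpack le_rfl)
  rw [tsum_range (fun b : E × ℝ => ENNReal.ofReal (h (Metric.diam (Metric.ball b.1 b.2)))) hg]
  have hcover : φ ⁻¹' F ⊆ ⋃ v : V, codeCylinder (n + 1) v.1 := fun u hu =>
    Set.mem_iUnion.2 ⟨⟨fun i => u i, u, fun _ => rfl, hu⟩, fun _ => rfl⟩
  calc ENNReal.ofReal c * codeMeasure N (φ ⁻¹' F)
      ≤ ENNReal.ofReal c * ∑' v : V, codeMeasure N (codeCylinder (n + 1) v.1) := by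
        gcongr
        exact (measure_mono hcover).trans (measure_iUnion_le _)
    _ = ∑' v : V, ENNReal.ofReal c * codeMeasure N (codeCylinder (n + 1) v.1) :=
        ENNReal.tsum_mul_left.symm
    _ ≤ _ := by
      refine ENNReal.tsum_le_tsum fun v => ?_
      simp only [g]
      -- In a nontrivial normed space a ball of radius `ρ n / 2` has diameter exactly `ρ n`.
      rw [codeMeasure_codeCylinder, ← ENNReal.ofReal_mul hc.le,
        Metric.diam_ball_eq _ (half_pos (hρ n)).le, mul_div_cancel₀ _ two_ne_zero]
      refine ENNReal.ofReal_le_ofReal (le_trans ?_ (hhρ n))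
      gcongr
      exact n.le_succ

lemma le_packingMeasure_range [NeZero N]
    (hφ : ∀ n w w', dist (φ w) (φ w') < ρ n → ∀ i ≤ n, w i = w' i)
    (hρ : ∀ n, 0 < ρ n) (hρ_lim : Tendsto ρ atTop (𝓝 0)) {c : ℝ} (hc : 0 < c)
    (hhρ : ∀ n, c * ((N : ℝ) ^ n)⁻¹ ≤ h (ρ n)) :
    ENNReal.ofReal c ≤ packingMeasure h (Set.range φ) := by
  refine le_iInf₂ fun F hF => ?_
  have hcover : (Set.univ : Set (ℕ → Fin N)) ⊆ ⋃ n, φ ⁻¹' F n := by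
    intro w _
    simpa using hF ⟨w, rfl⟩
  calc ENNReal.ofReal c = ENNReal.ofReal c * codeMeasure N Set.univ := by simp
    _ ≤ ENNReal.ofReal c * ∑' n, codeMeasure N (φ ⁻¹' F n) := by
      gcongr
      exact (measure_mono hcover).trans (measure_iUnion_le _)
    _ = ∑' n, ENNReal.ofReal c * codeMeasure N (φ ⁻¹' F n) := ENNReal.tsum_mul_left.symm
    _ ≤ _ := ENNReal.tsum_le_tsum fun n => le_packingPremeasure hφ hρ hρ_lim hc hhρ (F n)

end NormedCoding

/-! ### Tails of the series -/

section Tail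

variable {s : ℕ → ℝ}

lemma tail_eq_add (hs : Summable s) (n : ℕ) : tail s n = s n + tail s (n + 1) := by
  have h : Summable fun i => s (n + i) := by
    simpa only [add_comm] using (summable_nat_add_iff n).2 hs
  rw [tail, h.tsum_eq_zero_add, tail]
  simp only [add_zero, add_assoc, add_comm 1]

lemma tail_pos (hs : Summable s) (hpos : ∀ n, 0 < s n) (n : ℕ) : 0 < tail s n := by
  rw [tail_eq_add hs]
  exact add_pos_of_pos_of_nonneg (hpos n) (tsum_nonneg fun i => (hpos _).le)

lemma tendsto_tail_zero (s : ℕ → ℝ) : Tendsto (tail s) atTop (𝓝 0) := by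
  refine (tendsto_sum_nat_add s).congr fun n => ?_
  simp only [tail, add_comm n]

/-- Applied to digit differences with `K = κ`, this yields both distance bounds: the partial sum is
zero for the upper one and a single term for the lower one. -/
lemma norm_tsum_smul_sub_sum_le {E : Type*} [NormedAddCommGroup E] [NormedSpace ℝ E]
    [CompleteSpace E] (hs : Summable s) (hpos : ∀ n, 0 < s n) {e : ℕ → E} {K : ℝ}
    (he : ∀ i, ‖e i‖ ≤ K) (n : ℕ) :
    ‖∑' i, s i • e i - ∑ i ∈ Finset.range n, s i • e i‖ ≤ K * tail s n := by
  have hle : ∀ i, ‖s i • e i‖ ≤ K * s i := fun i => by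
    rw [norm_smul, Real.norm_of_nonneg (hpos i).le, mul_comm]
    exact mul_le_mul_of_nonneg_right (he i) (hpos i).le
  have hsum : Summable fun i => s i • e i := Summable.of_norm_bounded (hs.mul_left K) hle
  rw [← hsum.sum_add_tsum_nat_add n, add_sub_cancel_left]
  have h : HasSum (fun i => K * s (i + n)) (K * tail s n) := by
    have := ((summable_nat_add_iff n).2 hs).hasSum.mul_left K
    simpa only [tail, add_comm n] using this
  exact tsum_of_norm_bounded h fun i => hle _

end Tail

/-! ### Metric estimates for coded sums -/

section Digits

variable {p N : ℕ} {d : ℕ → Fin N → EuclideanSpace ℝ (Fin p)} {s : ℕ → ℝ}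

lemma tau_le_norm_sub (d : ℕ → Fin N → EuclideanSpace ℝ (Fin p)) (n : ℕ) {i j : Fin N}
    (hij : i ≠ j) : tau d ≤ ‖d n i - d n j‖ := by
  have h1 : tau d ≤ tauAt d n := by
    refine ciInf_le ⟨0, ?_⟩ n
    rintro _ ⟨m, rfl⟩
    exact Real.iInf_nonneg fun _ => norm_nonneg _
  exact h1.trans (ciInf_le (Set.finite_range _).bddBelow
    (⟨(i, j), hij⟩ : {q : Fin N × Fin N // q.1 ≠ q.2}))

lemma norm_sub_le_kappa_of_ne (hd : BddAbove (Set.range (kappaAt d))) (n : ℕ) {i j : Fin N}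
    (hij : i ≠ j) : ‖d n i - d n j‖ ≤ kappa d :=
  (le_ciSup (f := fun q : {q : Fin N × Fin N // q.1 ≠ q.2} => ‖d n q.1.1 - d n q.1.2‖)
    (Set.finite_range _).bddAbove ⟨(i, j), hij⟩).trans (le_ciSup hd n)

lemma tau_le_kappa (hN : 2 ≤ N) (hd : BddAbove (Set.range (kappaAt d))) : tau d ≤ kappa d := by
  have hij : (⟨0, by omega⟩ : Fin N) ≠ ⟨1, by omega⟩ := by simp
  exact (tau_le_norm_sub d 0 hij).trans (norm_sub_le_kappa_of_ne hd 0 hij)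

lemma norm_sub_le_kappa (hd : BddAbove (Set.range (kappaAt d))) (hk : 0 ≤ kappa d) (n : ℕ)
    (i j : Fin N) : ‖d n i - d n j‖ ≤ kappa d := by
  rcases eq_or_ne i j with rfl | hij
  · simpa using hk
  · exact norm_sub_le_kappa_of_ne hd n hij

/-- The point of the sum set with a given code. -/
noncomputable def codedSum (s : ℕ → ℝ) (d : ℕ → Fin N → EuclideanSpace ℝ (Fin p))
    (w : ℕ → Fin N) : EuclideanSpace ℝ (Fin p) :=
  ∑' i, s i • d i (w i)

lemma summable_codedSum (hs : Summable s) (hpos : ∀ n, 0 < s n) {K : ℝ}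
    (hK : ∀ n i, ‖d n i‖ ≤ K) (w : ℕ → Fin N) : Summable fun i => s i • d i (w i) := by
  refine Summable.of_norm_bounded (hs.mul_left K) fun i => ?_
  rw [norm_smul, Real.norm_of_nonneg (hpos i).le, mul_comm]
  exact mul_le_mul_of_nonneg_right (hK _ _) (hpos i).le

lemma sumSet_eq_range_codedSum (hs : Summable s) (hpos : ∀ n, 0 < s n) {K : ℝ}
    (hK : ∀ n i, ‖d n i‖ ≤ K) : sumSet s d = Set.range (codedSum s d) := by
  ext x
  constructor
  · rintro ⟨b, hb, hx⟩
    choose w hw using hb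
    obtain rfl : (fun i => d i (w i)) = b := funext hw
    exact ⟨w, hx.tsum_eq⟩
  · rintro ⟨w, rfl⟩
    exact ⟨fun i => d i (w i), fun i => ⟨w i, rfl⟩, (summable_codedSum hs hpos hK w).hasSum⟩

lemma codedSum_sub (hs : Summable s) (hpos : ∀ n, 0 < s n) {K : ℝ}
    (hK : ∀ n i, ‖d n i‖ ≤ K) (w w' : ℕ → Fin N) :
    codedSum s d w - codedSum s d w' = ∑' i, s i • (d i (w i) - d i (w' i)) := by
  simp only [smul_sub]
  exact ((summable_codedSum hs hpos hK w).tsum_sub (summable_codedSum hs hpos hK w')).symm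

lemma dist_codedSum_le (hs : Summable s) (hpos : ∀ n, 0 < s n) {K : ℝ}
    (hK : ∀ n i, ‖d n i‖ ≤ K) (hdiff : ∀ n i j, ‖d n i - d n j‖ ≤ K) (n : ℕ) (w w' : ℕ → Fin N)
    (hww' : ∀ i < n, w i = w' i) : dist (codedSum s d w) (codedSum s d w') ≤ K * tail s n := by
  have h := norm_tsum_smul_sub_sum_le hs hpos (fun i => hdiff i (w i) (w' i)) n
  have h0 : ∑ i ∈ Finset.range n, s i • (d i (w i) - d i (w' i)) = 0 :=
    Finset.sum_eq_zero fun i hi => by simp [hww' i (Finset.mem_range.1 hi)]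
  rwa [h0, sub_zero, ← codedSum_sub hs hpos hK, ← dist_eq_norm] at h

lemma le_dist_codedSum (hs : Summable s) (hpos : ∀ n, 0 < s n) {K : ℝ}
    (hK : ∀ n i, ‖d n i‖ ≤ K) (hdiff : ∀ n i j, ‖d n i - d n j‖ ≤ K) {n : ℕ} {w w' : ℕ → Fin N}
    (hww' : ∀ i < n, w i = w' i) (hne : w n ≠ w' n) :
    tau d * s n - K * tail s (n + 1) ≤ dist (codedSum s d w) (codedSum s d w') := by
  have h := norm_tsum_smul_sub_sum_le hs hpos (fun i => hdiff i (w i) (w' i)) (n + 1)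
  have h0 : ∑ i ∈ Finset.range n, s i • (d i (w i) - d i (w' i)) = 0 :=
    Finset.sum_eq_zero fun i hi => by simp [hww' i (Finset.mem_range.1 hi)]
  rw [Finset.sum_range_succ, h0, zero_add, ← codedSum_sub hs hpos hK] at h
  have h1 : tau d * s n ≤ ‖s n • (d n (w n) - d n (w' n))‖ := by
    rw [norm_smul, Real.norm_of_nonneg (hpos n).le, mul_comm]
    exact mul_le_mul_of_nonneg_left (tau_le_norm_sub d n hne) (hpos n).le
  have h2 := norm_sub_norm_le (s n • (d n (w n) - d n (w' n)))
    (codedSum s d w - codedSum s d w')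
  rw [norm_sub_rev (s n • _)] at h2
  rw [dist_eq_norm]
  linarith

end Digits

end SumSet

/-! ### Assembly of the theorem -/

open SumSet

theorem theorem2 {p N : ℕ} (hN : 2 ≤ N)
    (s : ℕ → ℝ) (hs_pos : ∀ n, 0 < s n) (hs_sum : Summable s)
    (d : ℕ → Fin N → EuclideanSpace ℝ (Fin p))
    (hd_zero : ∀ n, d n ⟨0, by omega⟩ = 0)
    (h_kappa : BddAbove (Set.range (SumSet.kappaAt d)))
    (h_tau : 0 < SumSet.tau d)
    (M : ℝ)
    (hM : IsLUB (Set.range fun n : ℕ =>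
      SumSet.kappa d * SumSet.tail s (n + 1) / (SumSet.tau d * s n)) M)
    (hM_lt : M < 1) :
    ∃ h : ℝ → ℝ, SumSet.IsDimensionFunction h ∧ SumSet.IsDoubling h ∧
      (∀ n : ℕ, ∀ t ∈ Set.Ico ((N : ℝ) ^ n) ((N : ℝ) ^ (n + 1)),
        h (SumSet.interp s d n t) = 1 / t) ∧
      (∀ n : ℕ, (N : ℝ) ^ n * h (SumSet.kappa d * SumSet.tail s n) = 1) ∧
      SumSet.IsHausdorffSet h (SumSet.sumSet s d) ∧
      SumSet.IsPackingSet h (SumSet.sumSet s d) := by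
  have : NeZero N := ⟨by omega⟩
  have hN0 : (0 : ℝ) < N := by exact_mod_cast (by omega : 0 < N)
  have hτκ : tau d ≤ kappa d := tau_le_kappa hN h_kappa
  have hκ : 0 < kappa d := h_tau.trans_le hτκ
  have hdiff := norm_sub_le_kappa h_kappa hκ.le
  have hnorm : ∀ n i, ‖d n i‖ ≤ kappa d := fun n i => by
    have hle := hdiff n i ⟨0, by omega⟩
    rwa [hd_zero, sub_zero] at hle
  have : Nontrivial (EuclideanSpace ℝ (Fin p)) := by
    refine ⟨d 0 ⟨0, by omega⟩, d 0 ⟨1, by omega⟩, fun heq => ?_⟩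
    have hle := tau_le_norm_sub d 0 (i := ⟨0, by omega⟩) (j := ⟨1, by omega⟩) (by simp)
    rw [heq, sub_self, norm_zero] at hle
    exact absurd h_tau (not_lt.2 hle)
  have htail := tail_pos hs_sum hs_pos
  have hratio : ∀ n, kappa d * tail s (n + 1) ≤ M * (tau d * s n) := fun n =>
    (div_le_iff₀ (mul_pos h_tau (hs_pos n))).1 (hM.1 ⟨n, rfl⟩)
  have hratio_one : ∀ n, kappa d * tail s (n + 1) ≤ tau d * s n := fun n =>
    (hratio n).trans (mul_le_of_le_one_left (mul_pos h_tau (hs_pos n)).le hM_lt.le)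
  have htail_le : ∀ n, tail s (n + 1) ≤ s n := fun n => by
    refine le_of_mul_le_mul_left ((hratio_one n).trans ?_) hκ
    exact mul_le_mul_of_nonneg_right hτκ (hs_pos n).le
  -- The term `s (n + 1)` is part of `R_{n+1} ≤ s n`.
  have hs_anti : Antitone s := antitone_nat_of_succ_le fun n => by
    linarith [htail_le n, tail_eq_add hs_sum (n + 1), htail (n + 1 + 1)]
  set a : ℕ → ℝ := fun n => kappa d * tail s n with ha_def
  have ha_pos : ∀ n, 0 < a n := fun n => mul_pos hκ (htail n)
  have ha_anti : StrictAnti a := strictAnti_nat_of_succ_lt fun n =>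
    mul_lt_mul_of_pos_left (by linarith [tail_eq_add hs_sum n, hs_pos n]) hκ
  have ha_lim : Tendsto a atTop (𝓝 0) := by
    simpa using (tendsto_tail_zero s).const_mul (kappa d)
  have ha_two : ∀ n, 2 * a (n + 1) ≤ a n := fun n => by
    have := mul_le_mul_of_nonneg_left (htail_le n) hκ.le
    simp only [ha_def, tail_eq_add hs_sum n, mul_add]
    linarith
  set ρ : ℕ → ℝ := fun n => (1 - M) * tau d * s n with hρ_def
  have hMτ : 0 < (1 - M) * tau d := mul_pos (by linarith) h_tau
  have hρ_pos : ∀ n, 0 < ρ n := fun n => mul_pos hMτ (hs_pos n)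
  have hρ_lim : Tendsto ρ atTop (𝓝 0) := by
    simpa using hs_sum.tendsto_atTop_zero.const_mul ((1 - M) * tau d)
  have hupper := dist_codedSum_le hs_sum hs_pos hnorm hdiff
  -- At a first disagreement `i ≤ n` the distance would be at least `ρ i ≥ ρ n`.
  have hlower : ∀ n w w', dist (codedSum s d w) (codedSum s d w') < ρ n →
      ∀ i ≤ n, w i = w' i := by
    intro n w w' hlt i
    induction i using Nat.strong_induction_on with
    | _ i ih =>
      intro hi
      by_contra hne
      have h1 := le_dist_codedSum hs_sum hs_pos hnorm hdiff
        (fun j hj => ih j hj (hj.le.trans hi)) hne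
      have h2 : ρ n ≤ ρ i := mul_le_mul_of_nonneg_left (hs_anti hi) hMτ.le
      have h3 := hratio i
      simp only [hρ_def] at h2 hlt
      linarith
  have hmono := monotone_gauge hN ha_anti
  have hdouble : ∀ x, 0 < x → gauge N a (2 * x) ≤ (N : ℝ) ^ 2 * gauge N a x := fun x hx =>
    gauge_two_mul_le hN ha_anti ha_lim ha_two hx
  have hC : (0 : ℝ) < (N : ℝ) ^ 2 := by positivity
  have hgauge := gauge_apply hN ha_anti
  obtain ⟨c, hc, hcle⟩ : ∃ c, 0 < c ∧ ∀ n, c * ((N : ℝ) ^ n)⁻¹ ≤ gauge N a (ρ n) := by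
    -- This `θ` satisfies `θ * a n ≤ ρ n`, because `R_n = s n + R_{n+1} ≤ 2 s n`.
    obtain ⟨c, hc, hcle⟩ := exists_mul_le_of_doubling hC hmono hdouble
      (θ := (1 - M) * tau d / (2 * kappa d)) (by positivity)
    refine ⟨c, hc, fun n => ?_⟩
    rw [← hgauge n]
    refine (hcle (a n) (ha_pos n)).trans (hmono ?_)
    have h1 : tail s n ≤ 2 * s n := by linarith [tail_eq_add hs_sum n, htail_le n]
    calc (1 - M) * tau d / (2 * kappa d) * a n = (1 - M) * tau d * (tail s n / 2) := by
          simp only [ha_def]; field_simp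
      _ ≤ (1 - M) * tau d * s n := mul_le_mul_of_nonneg_left (by linarith) hMτ.le
  have hc' : 0 < ENNReal.ofReal c := ENNReal.ofReal_pos.2 hc
  refine ⟨gauge N a, ⟨(continuous_gauge hN ha_anti).continuousOn, hmono.monotoneOn _,
    gauge_zero hN ha_anti ha_pos⟩, ⟨_, hC, hdouble⟩,
    fun n t ht => gauge_interpolation hN ha_anti ht, fun n => ?_, ?_, ?_⟩
  · have h1 := hgauge n
    simp only [ha_def] at h1 ⊢
    rw [h1]
    exact mul_inv_cancel₀ (by positivity)
  · rw [sumSet_eq_range_codedSum hs_sum hs_pos hnorm]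
    exact ⟨hc'.trans_le (le_hausdorffMeasure_range hN hlower hρ_pos hρ_lim hmono hc hcle),
      (hausdorffMeasure_range_le_one hupper (fun n => (ha_pos n).le) ha_lim hmono
        hgauge).trans_lt ENNReal.one_lt_top⟩
  · rw [sumSet_eq_range_codedSum hs_sum hs_pos hnorm]
    exact ⟨hc'.trans_le (le_packingMeasure_range hlower hρ_pos hρ_lim hc hcle),
      ((packingMeasure_le_packingPremeasure _).trans (packingPremeasure_range_le hupper ha_pos
        ha_lim hmono hgauge hC hdouble)).trans_lt ENNReal.ofReal_lt_top⟩
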